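/- Let $n,\ell\in\mathbb N$ with $n\le 4$ and $\ell\ge 2$, let $m_0\ge 0$ and $m_1,\dots,m_n>0$, and take the gravitational constant equal to $1$. For radii $0<r_1<\dots<r_n$, the associated $n\times\ell+1$ spiderweb consists of a body of mass $m_0$ at the origin and, for each $i\in\{1,\dots,n\}$ and $k\in\{0,\dots,\ell-1\}$, a body of mass $m_i$ at the point $r_i(\cos\frac{2\pi k}{\ell},\sin\frac{2\pi k}{\ell},0)\in\mathbb R^3$. Bodies with masses $\mu_a$ at pairwise distinct positions $q_a\in\mathbb R^3$ form a central configuration with constant $\lambda\in\mathbb R$ if $$-\sum_{b\ne a}\frac{\mu_b\,(q_a-q_b)}{|q_a-q_b|^3}=\lambda\, q_a\qquad\text{for every body } a.$$ (1) For every $\lambda<0$ there exist radii $0<r_1<\dots<r_n$ whose $n\times\ell+1$ spiderweb is a central configuration with constant $\lambda$. In particular, an $n\times\ell+1$ spiderweb central configuration exists. (2) If $n=2$, then for each fixed $\lambda$ there is at most one pair of radii $0<r_1<r_2$ whose $2\times\ell+1$ spiderweb is a central configuration with constant $\lambda$; hence for each $\lambda<0$ there is exactly one. -/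

import Mathlib

/-- Newtonian acceleration (gravitational constant `G = 1`) of the `i`-th of finitely many bodies
with masses `m` and positions `q` in `ℝ³`:
`q̈ᵢ = - ∑_{j ≠ i} mⱼ (qᵢ - qⱼ) / |qᵢ - qⱼ|³`.
The mass of the `i`-th body itself has been divided out, so the formula also makes sense for a body
of mass zero. -/
noncomputable def newtonAcceleration {ι : Type*} [Fintype ι] [DecidableEq ι]
    (m : ι → ℝ) (q : ι → EuclideanSpace ℝ (Fin 3)) (i : ι) : EuclideanSpace ℝ (Fin 3) :=
  -∑ j ∈ Finset.univ.erase i, (m j / ‖q i - q j‖ ^ 3) • (q i - q j)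

/-- Bodies with masses `m` at the pairwise distinct positions `q` form a central configuration
with constant `lam`: the acceleration of every body is `lam` times its position. -/
def IsCentralConfiguration {ι : Type*} [Fintype ι] [DecidableEq ι]
    (m : ι → ℝ) (q : ι → EuclideanSpace ℝ (Fin 3)) (lam : ℝ) : Prop :=
  Function.Injective q ∧ ∀ i, newtonAcceleration m q i = lam • q i

/-- The admissible vectors of radii: `0 < r₁ < ⋯ < rₙ`. -/
def orderedRadii (n : ℕ) : Set (Fin n → ℝ) :=
  {r | (∀ i, 0 < r i) ∧ StrictMono r}

/-- Positions of the `n × ℓ + 1` bodies of a spiderweb: the body `none` is at the origin, and the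
body `some (i, k)` is at the intersection of the circle of radius `r i` with the half-line of angle
`2 π k / ℓ` in the horizontal plane, `k = 0, …, ℓ - 1`. -/
noncomputable def spiderwebPosition {n ℓ : ℕ} (r : Fin n → ℝ) :
    Option (Fin n × Fin ℓ) → EuclideanSpace ℝ (Fin 3)
  | none => 0
  | some (i, k) =>
      !₂[r i * Real.cos (2 * Real.pi * (k : ℕ) / ℓ), r i * Real.sin (2 * Real.pi * (k : ℕ) / ℓ), 0]

/-- Masses of the `n × ℓ + 1` bodies of a spiderweb: `m₀` at the origin, and `m i` for each of the
`ℓ` bodies on the `i`-th circle. -/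
def spiderwebMass {n ℓ : ℕ} (m₀ : ℝ) (m : Fin n → ℝ) : Option (Fin n × Fin ℓ) → ℝ
  | none => m₀
  | some (i, _) => m i

/-- The radii `r` (with `0 < r₁ < ⋯ < rₙ`) give an `n × ℓ + 1` spiderweb central configuration with
central mass `m₀`, masses `m` on the circles, and constant `lam`. -/
def IsSpiderwebCentralConfiguration (n ℓ : ℕ) (m₀ : ℝ) (m : Fin n → ℝ) (lam : ℝ)
    (r : Fin n → ℝ) : Prop :=
  r ∈ orderedRadii n ∧
    IsCentralConfiguration (spiderwebMass (ℓ := ℓ) m₀ m) (spiderwebPosition (ℓ := ℓ) r) lam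

/-!
Central configurations with constant `λ` are the critical points of the augmented potential
`U - (λ / 2) I`, where `U` is the Newtonian potential and `I = ∑ mₐ |qₐ|²` the moment of inertia.
The acceleration of a spiderweb inherits its rotation and reflection symmetries, so it vanishes at
the origin and is radial on the rings, and it suffices to look for critical points as a function of
the radii. For `λ < 0` the augmented potential blows up at collisions and at infinity, hence attains
a minimum.

In the logarithms of the radii the augmented potential is strictly convex, so it has at most one
critical point. Indeed `I` is a positive combination of exponentials, and by the binomial series of
`|1 - z|⁻¹ = (1 - z) ^ (-1 / 2) * (1 - conj z) ^ (-1 / 2)` the mutual potential of two rings of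
radii `x < y` is a series of terms `c * x ^ k * y⁻¹ ^ (k + 1)`; here `c ≥ 0` because summing the
phases over both rings produces squared absolute values. A configuration with `λ ≥ 0` does not
exist, since `λ I = -U` by the virial identity.
-/

open scoped ComplexConjugate RealInnerProductSpace

section Newton

theorem hasDerivAt_inv_norm {E : Type*} [NormedAddCommGroup E] [InnerProductSpace ℝ E]
    {v : ℝ → E} {v' : E} {t : ℝ} (hv : HasDerivAt v v' t) (h : v t ≠ 0) :
    HasDerivAt (fun s => ‖v s‖⁻¹) (-(⟪v t, v'⟫ / ‖v t‖ ^ 3)) t := by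
  have hn : ‖v t‖ ≠ 0 := norm_ne_zero_iff.mpr h
  have hinv := (hv.norm_sq.sqrt (pow_ne_zero 2 hn)).fun_inv
    (by rwa [Real.sqrt_sq (norm_nonneg _)])
  simp only [Real.sqrt_sq (norm_nonneg _)] at hinv
  exact hinv.congr_deriv (by field_simp)

/-- The Newtonian potential (the negative of the potential energy) of bodies with masses `m` at
the positions `q`. The sum runs over all ordered pairs, whence the factor `1 / 2`; its diagonal
terms vanish because `0⁻¹ = 0`. -/
noncomputable def newtonPotential {ι E : Type*} [Fintype ι] [NormedAddCommGroup E]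
    (m : ι → ℝ) (q : ι → E) : ℝ :=
  2⁻¹ * ∑ a, ∑ b, m a * m b * ‖q a - q b‖⁻¹

/-- The Newtonian potential augmented by a multiple of the moment of inertia. Its critical points
are the central configurations with constant `lam`. -/
noncomputable def augmentedPotential {ι E : Type*} [Fintype ι] [NormedAddCommGroup E]
    (m : ι → ℝ) (lam : ℝ) (q : ι → E) : ℝ :=
  newtonPotential m q - lam / 2 * ∑ a, m a * ‖q a‖ ^ 2

section Potential

variable {ι E : Type*} [Fintype ι] [NormedAddCommGroup E] {m : ι → ℝ} {lam : ℝ}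

theorem newtonPotential_nonneg (hm : ∀ a, 0 ≤ m a) (q : ι → E) : 0 ≤ newtonPotential m q :=
  mul_nonneg (by norm_num) (Finset.sum_nonneg fun a _ => Finset.sum_nonneg fun b _ =>
    mul_nonneg (mul_nonneg (hm a) (hm b)) (by positivity))

theorem mul_le_two_mul_newtonPotential_mul_norm_sub (hm : ∀ a, 0 ≤ m a) {q : ι → E} {a b : ι}
    (hab : q a ≠ q b) : m a * m b ≤ 2 * newtonPotential m q * ‖q a - q b‖ := by
  have hterm : ∀ a b, 0 ≤ m a * m b * ‖q a - q b‖⁻¹ := fun a b =>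
    mul_nonneg (mul_nonneg (hm a) (hm b)) (by positivity)
  have hpair : m a * m b * ‖q a - q b‖⁻¹ ≤ 2 * newtonPotential m q := calc
    _ ≤ ∑ b, m a * m b * ‖q a - q b‖⁻¹ :=
      Finset.single_le_sum (fun b _ => hterm a b) (Finset.mem_univ b)
    _ ≤ ∑ a, ∑ b, m a * m b * ‖q a - q b‖⁻¹ :=
      Finset.single_le_sum (f := fun a => ∑ b, m a * m b * ‖q a - q b‖⁻¹)
        (fun a _ => Finset.sum_nonneg fun b _ => hterm a b) (Finset.mem_univ a)
    _ = 2 * newtonPotential m q := by rw [newtonPotential, mul_inv_cancel_left₀ two_ne_zero]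
  rwa [← div_eq_mul_inv, div_le_iff₀ (norm_pos_iff.mpr (sub_ne_zero.mpr hab))] at hpair

theorem newtonPotential_le_augmentedPotential (hm : ∀ a, 0 ≤ m a) (hlam : lam ≤ 0) (q : ι → E) :
    newtonPotential m q ≤ augmentedPotential m lam q :=
  le_sub_self_iff _ |>.mpr <| mul_nonpos_of_nonpos_of_nonneg (by linarith) <|
    Finset.sum_nonneg fun a _ => mul_nonneg (hm a) (sq_nonneg _)

theorem mul_norm_sq_le_augmentedPotential (hm : ∀ a, 0 ≤ m a) (hlam : lam ≤ 0) (q : ι → E)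
    (a : ι) : -lam / 2 * (m a * ‖q a‖ ^ 2) ≤ augmentedPotential m lam q := by
  have hsum : m a * ‖q a‖ ^ 2 ≤ ∑ b, m b * ‖q b‖ ^ 2 :=
    Finset.single_le_sum (f := fun b => m b * ‖q b‖ ^ 2)
      (fun b _ => mul_nonneg (hm b) (sq_nonneg _)) (Finset.mem_univ a)
  have hinertia := mul_le_mul_of_nonneg_left hsum (show 0 ≤ -lam / 2 by linarith)
  rw [augmentedPotential]
  linarith [newtonPotential_nonneg hm q]

theorem continuousOn_newtonPotential (m : ι → ℝ) :
    ContinuousOn (newtonPotential m) {q : ι → E | Function.Injective q} := by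
  refine continuousOn_const.mul (continuousOn_finsetSum _ fun a _ =>
    continuousOn_finsetSum _ fun b _ => ?_)
  obtain rfl | hab := eq_or_ne a b
  · simpa only [sub_self, norm_zero, inv_zero, mul_zero] using continuousOn_const
  · refine continuousOn_const.mul (ContinuousOn.inv₀ (by fun_prop) fun q hq => ?_)
    exact norm_ne_zero_iff.mpr (sub_ne_zero.mpr (hq.ne hab))

theorem continuousOn_augmentedPotential (m : ι → ℝ) (lam : ℝ) :
    ContinuousOn (augmentedPotential m lam) {q : ι → E | Function.Injective q} :=
  (continuousOn_newtonPotential m).sub (by fun_prop)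

end Potential

section Acceleration

variable {ι : Type*} [Fintype ι] [DecidableEq ι]

theorem newtonAcceleration_eq_neg_sum (m : ι → ℝ) (q : ι → EuclideanSpace ℝ (Fin 3)) (a : ι) :
    newtonAcceleration m q a = -∑ b, (m b / ‖q a - q b‖ ^ 3) • (q a - q b) := by
  rw [newtonAcceleration, Finset.sum_erase _ (by rw [sub_self, smul_zero])]

/-- Newton's third law: the forces of each pair of bodies are opposite. -/
theorem sum_mul_inner_newtonAcceleration (m : ι → ℝ) (q v : ι → EuclideanSpace ℝ (Fin 3)) :
    ∑ a, m a * ⟪newtonAcceleration m q a, v a⟫ =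
      -(2⁻¹ * ∑ a, ∑ b, m a * m b * (⟪q a - q b, v a - v b⟫ / ‖q a - q b‖ ^ 3)) := by
  set T : ι → ι → ℝ := fun a b => m a * m b * (⟪q a - q b, v a⟫ / ‖q a - q b‖ ^ 3) with hT
  have hsplit : ∀ a b, m a * m b * (⟪q a - q b, v a - v b⟫ / ‖q a - q b‖ ^ 3) =
      T a b + T b a := by
    intro a b
    simp only [hT]
    rw [norm_sub_rev (q b), ← neg_sub (q a) (q b), inner_neg_left, inner_sub_right]
    ring
  have hforce : ∀ a, m a * ⟪newtonAcceleration m q a, v a⟫ = -∑ b, T a b := by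
    intro a
    rw [newtonAcceleration_eq_neg_sum, inner_neg_left, sum_inner, mul_neg, Finset.mul_sum]
    simp only [real_inner_smul_left, hT]
    exact congrArg _ (Finset.sum_congr rfl fun b _ => by ring)
  simp only [hsplit, hforce, Finset.sum_add_distrib, Finset.sum_neg_distrib]
  rw [Finset.sum_comm (f := fun a b => T b a), ← two_mul, inv_mul_cancel_left₀ two_ne_zero]

/-- The virial identity, which is Euler's relation for the potential, homogeneous of degree
`-1`. -/
theorem sum_mul_inner_newtonAcceleration_self (m : ι → ℝ) (q : ι → EuclideanSpace ℝ (Fin 3)) :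
    ∑ a, m a * ⟪newtonAcceleration m q a, q a⟫ = -newtonPotential m q := by
  have hinv : ∀ x : ℝ, x ^ 2 / x ^ 3 = x⁻¹ := fun x => by
    obtain rfl | hx := eq_or_ne x 0
    · simp
    · field_simp
  simp only [sum_mul_inner_newtonAcceleration, real_inner_self_eq_norm_sq, hinv, newtonPotential]

theorem hasDerivAt_newtonPotential (m : ι → ℝ) {q : ℝ → ι → EuclideanSpace ℝ (Fin 3)}
    {q' : ι → EuclideanSpace ℝ (Fin 3)} {t : ℝ}
    (hq : ∀ a, HasDerivAt (fun s => q s a) (q' a) t) (hinj : Function.Injective (q t)) :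
    HasDerivAt (fun s => newtonPotential m (q s))
      (∑ a, m a * ⟪newtonAcceleration m (q t) a, q' a⟫) t := by
  have hpair : ∀ a b, HasDerivAt (fun s => m a * m b * ‖q s a - q s b‖⁻¹)
      (m a * m b * -(⟪q t a - q t b, q' a - q' b⟫ / ‖q t a - q t b‖ ^ 3)) t := by
    intro a b
    obtain rfl | hab := eq_or_ne a b
    · simpa using hasDerivAt_const t (0 : ℝ)
    · exact (hasDerivAt_inv_norm ((hq a).fun_sub (hq b))
        (sub_ne_zero.mpr (hinj.ne hab))).const_mul _
  have hsum := (HasDerivAt.fun_sum fun a (_ : a ∈ Finset.univ) =>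
    HasDerivAt.fun_sum fun b (_ : b ∈ Finset.univ) => hpair a b).const_mul (2⁻¹ : ℝ)
  refine hsum.congr_deriv ?_
  simp only [sum_mul_inner_newtonAcceleration, mul_neg, Finset.sum_neg_distrib]

theorem hasDerivAt_augmentedPotential (m : ι → ℝ) (lam : ℝ)
    {q : ℝ → ι → EuclideanSpace ℝ (Fin 3)} {q' : ι → EuclideanSpace ℝ (Fin 3)} {t : ℝ}
    (hq : ∀ a, HasDerivAt (fun s => q s a) (q' a) t) (hinj : Function.Injective (q t)) :
    HasDerivAt (fun s => augmentedPotential m lam (q s))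
      (∑ a, m a * ⟪newtonAcceleration m (q t) a - lam • q t a, q' a⟫) t := by
  have hinertia := (HasDerivAt.fun_sum fun a (_ : a ∈ Finset.univ) =>
    (hq a).norm_sq.const_mul (m a)).const_mul (lam / 2)
  refine ((hasDerivAt_newtonPotential m hq hinj).fun_sub hinertia).congr_deriv ?_
  simp only [inner_sub_left, real_inner_smul_left, Finset.mul_sum, ← Finset.sum_sub_distrib]
  exact Finset.sum_congr rfl fun a _ => by ring

theorem IsCentralConfiguration.constant_neg {m : ι → ℝ} {q : ι → EuclideanSpace ℝ (Fin 3)}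
    {lam : ℝ} (h : IsCentralConfiguration m q lam) (hm : ∀ a, 0 ≤ m a) {a b : ι} (hab : a ≠ b)
    (ha : 0 < m a) (hb : 0 < m b) : lam < 0 := by
  have hvirial : lam * ∑ c, m c * ‖q c‖ ^ 2 = -newtonPotential m q := by
    rw [← sum_mul_inner_newtonAcceleration_self, Finset.mul_sum]
    refine Finset.sum_congr rfl fun c _ => ?_
    rw [h.2, real_inner_smul_left, real_inner_self_eq_norm_sq]
    ring
  have hpotential : 0 < newtonPotential m q := by
    have hle := mul_le_two_mul_newtonPotential_mul_norm_sub hm (h.1.ne hab)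
    linarith [pos_of_mul_pos_left ((mul_pos ha hb).trans_le hle) (norm_nonneg _)]
  by_contra! hlam
  have hinertia : 0 ≤ lam * ∑ c, m c * ‖q c‖ ^ 2 :=
    mul_nonneg hlam (Finset.sum_nonneg fun c _ => mul_nonneg (hm c) (sq_nonneg _))
  linarith

theorem newtonAcceleration_apply_perm (m : ι → ℝ) (q : ι → EuclideanSpace ℝ (Fin 3))
    (L : EuclideanSpace ℝ (Fin 3) →ₗᵢ[ℝ] EuclideanSpace ℝ (Fin 3)) (σ : Equiv.Perm ι)
    (hm : ∀ a, m (σ a) = m a) (hq : ∀ a, q (σ a) = L (q a)) (a : ι) :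
    newtonAcceleration m q (σ a) = L (newtonAcceleration m q a) := by
  rw [newtonAcceleration_eq_neg_sum, newtonAcceleration_eq_neg_sum, map_neg, map_sum,
    ← Equiv.sum_comp σ]
  simp only [hm, hq, ← map_sub, L.norm_map, map_smul]

end Acceleration

end Newton

section Symmetry

/-- The horizontal plane of `ℝ³`, which contains the bodies of a spiderweb, as an isometric copy
of `ℂ`. -/
noncomputable def horizontal : ℂ →ₗᵢ[ℝ] EuclideanSpace ℝ (Fin 3) where
  toFun z := !₂[z.re, z.im, 0]
  map_add' z w := by ext i; fin_cases i <;> simp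
  map_smul' c z := by ext i; fin_cases i <;> simp
  norm_map' z := by
    simp [EuclideanSpace.norm_eq, Fin.sum_univ_three, Complex.norm_eq_sqrt_sq_add_sq]

theorem horizontal_apply (z : ℂ) : horizontal z = !₂[z.re, z.im, 0] := rfl

/-- The rotation of `ℝ³` about the vertical axis which multiplies the horizontal plane by `w`. -/
noncomputable def verticalRotation (w : Circle) :
    EuclideanSpace ℝ (Fin 3) →ₗᵢ[ℝ] EuclideanSpace ℝ (Fin 3) where
  toFun v := !₂[(w : ℂ).re * v 0 - (w : ℂ).im * v 1, (w : ℂ).im * v 0 + (w : ℂ).re * v 1, v 2]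
  map_add' v v' := by ext i; fin_cases i <;> simp <;> ring
  map_smul' c v := by ext i; fin_cases i <;> simp <;> ring
  norm_map' v := by
    have hw : (w : ℂ).re * (w : ℂ).re + (w : ℂ).im * (w : ℂ).im = 1 := Circle.normSq_coe w
    have hsq : ((w : ℂ).re * v 0 - (w : ℂ).im * v 1) ^ 2 +
        ((w : ℂ).im * v 0 + (w : ℂ).re * v 1) ^ 2 = v 0 ^ 2 + v 1 ^ 2 := by
      linear_combination (v 0 ^ 2 + v 1 ^ 2) * hw
    simp [EuclideanSpace.norm_eq, Fin.sum_univ_three, hsq]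

theorem verticalRotation_horizontal (w : Circle) (z : ℂ) :
    verticalRotation w (horizontal z) = horizontal (w * z) := by
  ext i
  fin_cases i <;> simp [verticalRotation, horizontal_apply]
  ring

/-- The half-turn of `ℝ³` about the first coordinate axis. It acts on the horizontal plane as
complex conjugation. -/
noncomputable def halfTurn : EuclideanSpace ℝ (Fin 3) →ₗᵢ[ℝ] EuclideanSpace ℝ (Fin 3) where
  toFun v := !₂[v 0, -v 1, -v 2]
  map_add' v v' := by ext i; fin_cases i <;> simp <;> ring
  map_smul' c v := by ext i; fin_cases i <;> simp
  norm_map' v := by simp [EuclideanSpace.norm_eq, Fin.sum_univ_three]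

theorem halfTurn_horizontal (z : ℂ) : halfTurn (horizontal z) = horizontal (conj z) := by
  ext i
  fin_cases i <;> simp [halfTurn, horizontal_apply]

theorem eq_horizontal_of_halfTurn_eq_self {v : EuclideanSpace ℝ (Fin 3)} (h : halfTurn v = v) :
    v = horizontal (v 0 : ℝ) := by
  have h₁ : -v 1 = v 1 := congrArg (fun u => u 1) h
  have h₂ : -v 2 = v 2 := congrArg (fun u => u 2) h
  ext i
  fin_cases i
  · rfl
  · exact self_eq_neg.mp h₁.symm
  · exact self_eq_neg.mp h₂.symm

/-- The `k`-th vertex `exp (2 π i k / ℓ)` of the regular `ℓ`-gon inscribed in the unit circle. -/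
noncomputable def polygonVertex (ℓ : ℕ) [NeZero ℓ] (k : Fin ℓ) : Circle :=
  ZMod.toCircle ((k : ℕ) : ZMod ℓ)

section PolygonVertex

variable {ℓ : ℕ} [NeZero ℓ]

theorem polygonVertex_zero : polygonVertex ℓ 0 = 1 := by
  rw [polygonVertex, Fin.val_zero, Nat.cast_zero, AddChar.map_zero_eq_one]

theorem polygonVertex_add (k k' : Fin ℓ) :
    polygonVertex ℓ (k + k') = polygonVertex ℓ k * polygonVertex ℓ k' := by
  simp only [polygonVertex, Fin.val_add, ZMod.natCast_mod, Nat.cast_add, AddChar.map_add_eq_mul]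

theorem polygonVertex_neg (k : Fin ℓ) : polygonVertex ℓ (-k) = (polygonVertex ℓ k)⁻¹ :=
  eq_inv_of_mul_eq_one_left <| by rw [← polygonVertex_add, neg_add_cancel, polygonVertex_zero]

theorem polygonVertex_injective (ℓ : ℕ) [NeZero ℓ] : Function.Injective (polygonVertex ℓ) := by
  intro k k' h
  have hcast := ZMod.injective_toCircle h
  rw [ZMod.natCast_eq_natCast_iff', Nat.mod_eq_of_lt k.2, Nat.mod_eq_of_lt k'.2] at hcast
  exact Fin.ext hcast

theorem coe_polygonVertex (k : Fin ℓ) :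
    (polygonVertex ℓ k : ℂ) = Complex.exp ((2 * Real.pi * (k : ℕ) / ℓ : ℝ) * Complex.I) := by
  rw [polygonVertex, ZMod.toCircle_natCast]
  congr 1
  push_cast
  ring

end PolygonVertex

section Spiderweb

variable {n ℓ : ℕ}

theorem spiderwebPosition_none (r : Fin n → ℝ) : spiderwebPosition (ℓ := ℓ) r none = 0 := rfl

variable [NeZero ℓ]

theorem spiderwebPosition_some (r : Fin n → ℝ) (i : Fin n) (k : Fin ℓ) :
    spiderwebPosition r (some (i, k)) = r i • horizontal (polygonVertex ℓ k) := by
  ext j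
  rw [coe_polygonVertex, horizontal_apply, Complex.exp_ofReal_mul_I_re,
    Complex.exp_ofReal_mul_I_im]
  fin_cases j <;> simp [spiderwebPosition]

theorem norm_spiderwebPosition_some {r : Fin n → ℝ} {i : Fin n} (hr : 0 ≤ r i) (k : Fin ℓ) :
    ‖spiderwebPosition r (some (i, k))‖ = r i := by
  rw [spiderwebPosition_some, norm_smul, LinearIsometry.norm_map, Circle.norm_coe,
    Real.norm_of_nonneg hr, mul_one]

theorem spiderwebPosition_injective {r : Fin n → ℝ} (hr : r ∈ orderedRadii n) :
    Function.Injective (spiderwebPosition (ℓ := ℓ) r) := by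
  have hne : ∀ i (k : Fin ℓ), spiderwebPosition r (some (i, k)) ≠ 0 := fun i k => by
    rw [← norm_pos_iff, norm_spiderwebPosition_some (hr.1 i).le]
    exact hr.1 i
  rintro (_ | ⟨i, k⟩) (_ | ⟨j, k'⟩) h
  · rfl
  · exact (hne j k' h.symm).elim
  · exact (hne i k h).elim
  · obtain rfl : i = j := hr.2.injective <| by
      rw [← norm_spiderwebPosition_some (hr.1 i).le k, h,
        norm_spiderwebPosition_some (hr.1 j).le]
    rw [spiderwebPosition_some, spiderwebPosition_some] at h
    have hk := horizontal.injective (smul_right_injective _ (hr.1 i).ne' h)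
    rw [polygonVertex_injective ℓ (Circle.coe_injective hk)]

/-- The permutation of the bodies of a spiderweb induced by a permutation of its rays. -/
def rayPerm (n : ℕ) {ℓ : ℕ} (σ : Equiv.Perm (Fin ℓ)) : Equiv.Perm (Option (Fin n × Fin ℓ)) :=
  ((Equiv.refl _).prodCongr σ).optionCongr

theorem newtonAcceleration_spiderweb_rayPerm (m₀ : ℝ) (m r : Fin n → ℝ)
    {σ : Equiv.Perm (Fin ℓ)} {L : EuclideanSpace ℝ (Fin 3) →ₗᵢ[ℝ] EuclideanSpace ℝ (Fin 3)}
    (hL : ∀ k, L (horizontal (polygonVertex ℓ k)) = horizontal (polygonVertex ℓ (σ k)))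
    (a : Option (Fin n × Fin ℓ)) :
    newtonAcceleration (spiderwebMass m₀ m) (spiderwebPosition r) (rayPerm n σ a) =
      L (newtonAcceleration (spiderwebMass m₀ m) (spiderwebPosition r) a) := by
  refine newtonAcceleration_apply_perm _ _ L _ ?_ ?_ a
  · rintro (_ | ⟨i, k⟩) <;> rfl
  · rintro (_ | ⟨i, k⟩)
    · exact (map_zero L).symm
    · change spiderwebPosition r (some (i, σ k)) = _
      rw [spiderwebPosition_some, spiderwebPosition_some, map_smul, hL]

theorem newtonAcceleration_spiderweb_neg (m₀ : ℝ) (m r : Fin n → ℝ)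
    (a : Option (Fin n × Fin ℓ)) :
    newtonAcceleration (spiderwebMass m₀ m) (spiderwebPosition r) (rayPerm n (Equiv.neg _) a) =
      halfTurn (newtonAcceleration (spiderwebMass m₀ m) (spiderwebPosition r) a) :=
  newtonAcceleration_spiderweb_rayPerm m₀ m r (fun k => by
    rw [halfTurn_horizontal, Equiv.neg_apply, polygonVertex_neg, Circle.coe_inv_eq_conj]) a

theorem newtonAcceleration_spiderweb_add (m₀ : ℝ) (m r : Fin n → ℝ) (k : Fin ℓ)
    (a : Option (Fin n × Fin ℓ)) :
    newtonAcceleration (spiderwebMass m₀ m) (spiderwebPosition r)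
        (rayPerm n (Equiv.addLeft k) a) =
      verticalRotation (polygonVertex ℓ k)
        (newtonAcceleration (spiderwebMass m₀ m) (spiderwebPosition r) a) :=
  newtonAcceleration_spiderweb_rayPerm m₀ m r (fun k' => by
    rw [verticalRotation_horizontal, Equiv.coe_addLeft, polygonVertex_add, Circle.coe_mul]) a

/-- The half-turn makes the acceleration of the central body horizontal and the rotation by
`2 π / ℓ`, which moves every nonzero horizontal vector, then makes it vanish. -/
theorem newtonAcceleration_spiderweb_none (hℓ : 2 ≤ ℓ) (m₀ : ℝ) (m r : Fin n → ℝ) :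
    newtonAcceleration (spiderwebMass (ℓ := ℓ) m₀ m) (spiderwebPosition r) none = 0 := by
  set g := newtonAcceleration (spiderwebMass (ℓ := ℓ) m₀ m) (spiderwebPosition r) none
  have hg : g = horizontal (g 0 : ℝ) :=
    eq_horizontal_of_halfTurn_eq_self (newtonAcceleration_spiderweb_neg m₀ m r none).symm
  have hrot : g = verticalRotation (polygonVertex ℓ ⟨1, hℓ⟩) g :=
    newtonAcceleration_spiderweb_add m₀ m r ⟨1, hℓ⟩ none
  rw [hg, verticalRotation_horizontal] at hrot
  have hvertex : (polygonVertex ℓ ⟨1, hℓ⟩ : ℂ) ≠ 1 := by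
    rw [← Circle.coe_one, ← polygonVertex_zero (ℓ := ℓ)]
    exact Circle.coe_injective.ne ((polygonVertex_injective ℓ).ne (by simp [Fin.ext_iff]))
  rw [hg, by_contra fun h0 => hvertex ((right_eq_mul₀ h0).mp (horizontal.injective hrot)),
    map_zero]

/-- The common radial component of the accelerations of the bodies on the `i`-th circle, read off
at the body on the positive first coordinate axis. -/
noncomputable def radialAcceleration (ℓ : ℕ) [NeZero ℓ] (m₀ : ℝ) (m r : Fin n → ℝ)
    (i : Fin n) : ℝ :=
  newtonAcceleration (spiderwebMass (ℓ := ℓ) m₀ m) (spiderwebPosition r) (some (i, 0)) 0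

theorem newtonAcceleration_spiderweb_some (m₀ : ℝ) (m r : Fin n → ℝ) (i : Fin n) (k : Fin ℓ) :
    newtonAcceleration (spiderwebMass m₀ m) (spiderwebPosition r) (some (i, k)) =
      radialAcceleration ℓ m₀ m r i • horizontal (polygonVertex ℓ k) := by
  set g := newtonAcceleration (spiderwebMass (ℓ := ℓ) m₀ m) (spiderwebPosition r) (some (i, 0))
    with hg_def
  have hg : g = horizontal (radialAcceleration ℓ m₀ m r i : ℝ) := by
    refine eq_horizontal_of_halfTurn_eq_self (Eq.symm ?_)
    simpa [rayPerm] using newtonAcceleration_spiderweb_neg (ℓ := ℓ) m₀ m r (some (i, 0))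
  have hrot := newtonAcceleration_spiderweb_add m₀ m r k (some (i, 0))
  rw [← hg_def, hg, verticalRotation_horizontal, mul_comm, ← Complex.real_smul, map_smul] at hrot
  simpa [rayPerm] using hrot

theorem isSpiderwebCentralConfiguration_iff (hℓ : 2 ≤ ℓ) (m₀ : ℝ) (m : Fin n → ℝ) (lam : ℝ)
    (r : Fin n → ℝ) :
    IsSpiderwebCentralConfiguration n ℓ m₀ m lam r ↔
      r ∈ orderedRadii n ∧ ∀ i, radialAcceleration ℓ m₀ m r i = lam * r i := by
  refine and_congr_right fun hr => ⟨fun h i => ?_, fun h => ⟨spiderwebPosition_injective hr, ?_⟩⟩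
  · have hi := h.2 (some (i, 0))
    rw [newtonAcceleration_spiderweb_some, spiderwebPosition_some, smul_smul] at hi
    refine smul_left_injective ℝ ?_ hi
    rw [← norm_ne_zero_iff, LinearIsometry.norm_map, Circle.norm_coe]
    exact one_ne_zero
  · rintro (_ | ⟨i, k⟩)
    · rw [newtonAcceleration_spiderweb_none hℓ, spiderwebPosition_none, smul_zero]
    · rw [newtonAcceleration_spiderweb_some, spiderwebPosition_some, smul_smul, h]

end Spiderweb

end Symmetry

section RingPotential

theorem multichoose_nonneg {a : ℝ} (ha : 0 ≤ a) (n : ℕ) : 0 ≤ Ring.multichoose a n := by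
  have hfactorial : n.factorial • Ring.multichoose a n = (ascPochhammer ℝ n).eval a := by
    rw [Ring.factorial_nsmul_multichoose_eq_ascPochhammer, Polynomial.ascPochhammer_smeval_eq_eval]
  have hpochhammer : 0 ≤ (ascPochhammer ℝ n).eval a := by
    obtain rfl | ha := ha.eq_or_lt
    · rw [ascPochhammer_eval_zero]
      split_ifs <;> norm_num
    · exact (ascPochhammer_pos n a ha).le
  rw [← hfactorial] at hpochhammer
  exact (nsmul_nonneg_iff n.factorial_ne_zero).mp hpochhammer

theorem hasSum_multichoose_mul_pow (a : ℝ) {z : ℂ} (hz : ‖z‖ < 1) :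
    HasSum (fun n => ((Ring.multichoose a n : ℝ) : ℂ) * z ^ n) (1 / (1 - z) ^ (a : ℂ)) := by
  have hz' : z ∈ Metric.eball (0 : ℂ) 1 := by simpa [← ofReal_norm] using hz
  have h := (Complex.one_div_one_sub_cpow_hasFPowerSeriesOnBall_zero a).hasSum hz'
  simpa [FormalMultilinearSeries.ofScalars_apply_eq, Ring.multichoose_eq,
    Complex.ofReal_choose, mul_comm] using h

theorem hasSum_mul_of_finiteDimensional {ι κ R : Type*} [NormedRing R] [NormedAlgebra ℝ R]
    [FiniteDimensional ℝ R] {f : ι → R} {g : κ → R} {s t : R} (hf : HasSum f s)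
    (hg : HasSum g t) : HasSum (fun p : ι × κ => f p.1 * g p.2) (s * t) :=
  have := FiniteDimensional.complete ℝ R
  hf.mul hg (summable_mul_of_summable_norm hf.summable.norm hg.summable.norm)

theorem hasSum_multichoose_mul_pow_mul_conj_pow (a : ℝ) {z : ℂ} (hz : ‖z‖ < 1) :
    HasSum (fun p : ℕ × ℕ => ((Ring.multichoose a p.1 : ℝ) : ℂ) * z ^ p.1 *
      (((Ring.multichoose a p.2 : ℝ) : ℂ) * conj z ^ p.2)) (‖1 - z‖ ^ (-(2 * a)) : ℝ) := by
  have hsum := hasSum_multichoose_mul_pow a hz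
  have hconj : HasSum (fun n => ((Ring.multichoose a n : ℝ) : ℂ) * conj z ^ n)
      (conj (1 / (1 - z) ^ (a : ℂ))) := by
    simpa only [map_mul, map_pow, Complex.conj_ofReal] using Complex.hasSum_conj'.mpr hsum
  have hvalue : ‖1 / (1 - z) ^ (a : ℂ)‖ ^ 2 = ‖1 - z‖ ^ (-(2 * a)) := by
    rw [norm_div, norm_one, one_div, Complex.norm_cpow_real, Real.rpow_neg (norm_nonneg _),
      mul_comm, Real.rpow_mul (norm_nonneg _), inv_pow, Real.rpow_two]
  have hprod := hasSum_mul_of_finiteDimensional hsum hconj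
  rwa [Complex.mul_conj', ← Complex.ofReal_pow, hvalue] at hprod

/-- The summands multiply the binomial series of `(1 - ρ u) ^ (-1 / 2)` and its conjugate. -/
theorem hasSum_inv_norm_one_sub_mul_circle (u : Circle) {ρ : ℝ} (hρ : 0 ≤ ρ) (hρ1 : ρ < 1) :
    HasSum (fun p : ℕ × ℕ => (Ring.multichoose (1 / 2 : ℝ) p.1 *
      Ring.multichoose (1 / 2 : ℝ) p.2 * ρ ^ (p.1 + p.2) : ℝ) *
        ((u ^ (p.1 - p.2 : ℤ) : Circle) : ℂ)) (‖1 - (ρ * u : ℂ)‖⁻¹ : ℝ) := by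
  have hz : ‖(ρ * u : ℂ)‖ < 1 := by
    rwa [norm_mul, Circle.norm_coe, mul_one, Complex.norm_real, Real.norm_of_nonneg hρ]
  have h := hasSum_multichoose_mul_pow_mul_conj_pow (1 / 2) hz
  rw [mul_one_div_cancel two_ne_zero, Real.rpow_neg_one] at h
  refine h.congr_fun fun p => ?_
  rw [map_mul, Complex.conj_ofReal, ← Circle.coe_inv_eq_conj, zpow_sub, zpow_natCast, zpow_natCast,
    ← inv_pow, Circle.coe_mul, Circle.coe_pow, Circle.coe_pow]
  push_cast
  ring

/-- The mutual potential of unit masses at the points `x w k` and unit masses at the points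
`y w k`, which lie on the circles of radii `x` and `y` about the origin. -/
noncomputable def ringPotential {κ : Type*} [Fintype κ] (w : κ → Circle) (x y : ℝ) : ℝ :=
  ∑ k, ∑ k', ‖(x * w k - y * w k' : ℂ)‖⁻¹

variable {κ : Type*} [Fintype κ] (w : κ → Circle)

theorem ringPotential_comm (x y : ℝ) : ringPotential w x y = ringPotential w y x := by
  rw [ringPotential, Finset.sum_comm]
  simp only [norm_sub_rev, ringPotential]

theorem ringPotential_self {x : ℝ} (hx : 0 ≤ x) :
    ringPotential w x x = ringPotential w 1 1 * x⁻¹ := by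
  simp only [ringPotential, Finset.sum_mul]
  refine Finset.sum_congr rfl fun k _ => Finset.sum_congr rfl fun k' _ => ?_
  rw [← mul_sub, norm_mul, Complex.norm_real, Real.norm_of_nonneg hx, mul_inv, mul_comm]
  simp only [Complex.ofReal_one, one_mul]

theorem ringPotential_nonneg (x y : ℝ) : 0 ≤ ringPotential w x y :=
  Finset.sum_nonneg fun _ _ => Finset.sum_nonneg fun _ _ => by positivity

theorem norm_mul_circle_sub_mul_circle (u v : Circle) (x : ℝ) {y : ℝ} (hy : 0 < y) :
    ‖(x * u - y * v : ℂ)‖ = y * ‖1 - ((x / y : ℝ) * (u / v : Circle) : ℂ)‖ := by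
  have hy' : (y : ℂ) ≠ 0 := Complex.ofReal_ne_zero.mpr hy.ne'
  have hfactor : (x * u - y * v : ℂ) = -(y * v * (1 - (x / y : ℝ) * (u / v : Circle))) := by
    rw [Circle.coe_div, Complex.ofReal_div]
    field_simp [Circle.coe_ne_zero v]
    ring
  rw [hfactor, norm_neg, norm_mul, norm_mul, Circle.norm_coe, mul_one, Complex.norm_real,
    Real.norm_of_nonneg hy.le]

theorem sum_sum_div_zpow (d : ℤ) :
    ∑ k, ∑ k', (((w k / w k') ^ d : Circle) : ℂ) = (‖∑ k, ((w k ^ d : Circle) : ℂ)‖ ^ 2 : ℝ) := by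
  rw [Complex.ofReal_pow, ← Complex.mul_conj', map_sum, Finset.sum_mul_sum]
  simp only [div_eq_mul_inv, mul_zpow, inv_zpow, Circle.coe_mul, Circle.coe_inv_eq_conj]

/-- The coefficient of `x ^ (p.1 + p.2) * y⁻¹ ^ (p.1 + p.2 + 1)` in the expansion of
`ringPotential w x y`. -/
noncomputable def ringCoeff (p : ℕ × ℕ) : ℝ :=
  Ring.multichoose (1 / 2 : ℝ) p.1 * Ring.multichoose (1 / 2 : ℝ) p.2 *
    ‖∑ k, ((w k ^ (p.1 - p.2 : ℤ) : Circle) : ℂ)‖ ^ 2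

theorem ringCoeff_nonneg (p : ℕ × ℕ) : 0 ≤ ringCoeff w p :=
  mul_nonneg (mul_nonneg (multichoose_nonneg one_half_pos.le p.1)
    (multichoose_nonneg one_half_pos.le p.2)) (sq_nonneg _)

theorem hasSum_ringPotential {x y : ℝ} (hx : 0 ≤ x) (hxy : x < y) :
    HasSum (fun p => ringCoeff w p * (x ^ (p.1 + p.2) * y⁻¹ ^ (p.1 + p.2 + 1)))
      (ringPotential w x y) := by
  have hy : 0 < y := hx.trans_lt hxy
  have hpair := fun k k' =>
    (hasSum_inv_norm_one_sub_mul_circle (w k / w k') (div_nonneg hx hy.le)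
      ((div_lt_one hy).mpr hxy)).mul_left (y⁻¹ : ℂ)
  have hsum := hasSum_sum fun k (_ : k ∈ Finset.univ) =>
    hasSum_sum fun k' (_ : k' ∈ Finset.univ) => hpair k k'
  have hvalue : ((ringPotential w x y : ℝ) : ℂ) =
      ∑ k, ∑ k', (y⁻¹ : ℂ) * (‖1 - ((x / y : ℝ) * (w k / w k' : Circle) : ℂ)‖⁻¹ : ℝ) := by
    simp only [ringPotential, norm_mul_circle_sub_mul_circle _ _ x hy, mul_inv]
    push_cast
    rfl
  rw [← Complex.hasSum_ofReal, hvalue]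
  refine hsum.congr_fun fun p => ?_
  simp only [← Finset.mul_sum, sum_sum_div_zpow, ringCoeff]
  push_cast
  ring

end RingPotential

section Convexity

theorem convexOn_of_hasSum {ι E : Type*} [AddCommMonoid E] [Module ℝ E] {s : Set E}
    (hs : Convex ℝ s) {f : ι → E → ℝ} {g : E → ℝ} (hf : ∀ i, ConvexOn ℝ s (f i))
    (hg : ∀ x ∈ s, HasSum (fun i => f i x) (g x)) : ConvexOn ℝ s g :=
  ⟨hs, fun _ hx _ hy _ _ ha hb hab =>
    hasSum_le (fun i => (hf i).2 hx hy ha hb hab) (hg _ (hs hx hy ha hb hab))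
      (((hg _ hx).const_smul _).add ((hg _ hy).const_smul _))⟩

theorem convexOn_sum {ι E : Type*} [Fintype ι] [AddCommMonoid E] [Module ℝ E] {s : Set E}
    (hs : Convex ℝ s) {f : ι → E → ℝ} (hf : ∀ i, ConvexOn ℝ s (f i)) :
    ConvexOn ℝ s fun x => ∑ i, f i x :=
  convexOn_of_hasSum hs hf fun _ _ => hasSum_fintype _

theorem strictConvexOn_sum_comp_eval {ι : Type*} [Fintype ι] {φ : ι → ℝ → ℝ}
    (hφ : ∀ i, StrictConvexOn ℝ Set.univ (φ i)) :
    StrictConvexOn ℝ Set.univ fun u : ι → ℝ => ∑ i, φ i (u i) := by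
  refine ⟨convex_univ, fun u _ v _ huv a b ha hb hab => ?_⟩
  obtain ⟨i, hi⟩ := Function.ne_iff.mp huv
  simp only [Finset.smul_sum, ← Finset.sum_add_distrib]
  exact Finset.sum_lt_sum
    (fun j _ => (hφ j).convexOn.2 trivial trivial ha.le hb.le hab)
    ⟨i, Finset.mem_univ i, (hφ i).2 trivial trivial hi ha hb hab⟩

theorem convexOn_mul_exp_linearMap {E : Type*} [AddCommGroup E] [Module ℝ E] {c : ℝ} (hc : 0 ≤ c)
    (L : E →ₗ[ℝ] ℝ) : ConvexOn ℝ Set.univ fun x => c * Real.exp (L x) :=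
  (convexOn_exp.comp_linearMap L).smul hc

theorem strictConvexOn_mul_exp_sq {c : ℝ} (hc : 0 < c) :
    StrictConvexOn ℝ Set.univ fun t => c * Real.exp t ^ 2 := by
  refine ⟨convex_univ, fun x _ y _ hxy a b ha hb hab => ?_⟩
  have h := strictConvexOn_exp.2 (Set.mem_univ (2 * x)) (Set.mem_univ (2 * y))
    (mul_right_injective₀ two_ne_zero |>.ne hxy) ha hb hab
  have hmul := mul_lt_mul_of_pos_left h hc
  simp only [smul_eq_mul, ← Real.exp_nat_mul, Nat.cast_ofNat] at hmul ⊢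
  calc c * Real.exp (2 * (a * x + b * y)) = c * Real.exp (a * (2 * x) + b * (2 * y)) := by ring_nf
    _ < c * (a * Real.exp (2 * x) + b * Real.exp (2 * y)) := hmul
    _ = a * (c * Real.exp (2 * x)) + b * (c * Real.exp (2 * y)) := by ring

theorem convexOn_ringPotential_exp {κ : Type*} [Fintype κ] (w : κ → Circle) :
    ConvexOn ℝ {p : ℝ × ℝ | p.1 < p.2} fun p =>
      ringPotential w (Real.exp p.1) (Real.exp p.2) := by
  set L : ℕ × ℕ → ℝ × ℝ →ₗ[ℝ] ℝ := fun d =>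
    ((d.1 + d.2 : ℕ) : ℝ) • LinearMap.fst ℝ ℝ ℝ - ((d.1 + d.2 + 1 : ℕ) : ℝ) • LinearMap.snd ℝ ℝ ℝ
  have hL : ∀ d p, Real.exp (L d p) =
      Real.exp p.1 ^ (d.1 + d.2) * (Real.exp p.2)⁻¹ ^ (d.1 + d.2 + 1) := by
    intro d p
    rw [← Real.exp_neg, ← Real.exp_nat_mul, ← Real.exp_nat_mul, ← Real.exp_add, mul_neg,
      ← sub_eq_add_neg]
    rfl
  have hs : Convex ℝ {p : ℝ × ℝ | p.1 < p.2} := by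
    have h := convex_halfSpace_gt (LinearMap.snd ℝ ℝ ℝ - LinearMap.fst ℝ ℝ ℝ).isLinear 0
    simpa only [LinearMap.sub_apply, LinearMap.snd_apply, LinearMap.fst_apply, sub_pos] using h
  refine convexOn_of_hasSum hs (fun d => (convexOn_mul_exp_linearMap (ringCoeff_nonneg w d)
    (L d)).subset (Set.subset_univ _) hs) fun p hp => ?_
  simp only [hL]
  exact hasSum_ringPotential w (Real.exp_pos p.1).le (Real.exp_lt_exp.mpr hp)

theorem convex_setOf_strictMono (n : ℕ) : Convex ℝ {u : Fin n → ℝ | StrictMono u} :=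
  convex_iff_forall_pos.mpr fun _ hu _ hv _ _ ha hb _ => (hu.const_mul ha).add (hv.const_mul hb)

variable {n ℓ : ℕ} [NeZero ℓ]

theorem newtonPotential_spiderweb (m₀ : ℝ) (m : Fin n → ℝ) {r : Fin n → ℝ} (hr : ∀ i, 0 ≤ r i) :
    newtonPotential (spiderwebMass (ℓ := ℓ) m₀ m) (spiderwebPosition r) =
      ∑ i, ℓ * (m₀ * m i) * (r i)⁻¹ +
        2⁻¹ * ∑ i, ∑ j, m i * m j * ringPotential (polygonVertex ℓ) (r i) (r j) := by
  have hpair : ∀ i j, m i * m j * ringPotential (polygonVertex ℓ) (r i) (r j) =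
      ∑ k : Fin ℓ, ∑ k' : Fin ℓ, m i * m j *
        ‖spiderwebPosition r (some (i, k)) - spiderwebPosition r (some (j, k'))‖⁻¹ := by
    intro i j
    simp only [ringPotential, Finset.mul_sum, spiderwebPosition_some, ← map_smul, ← map_sub,
      LinearIsometry.norm_map, Complex.real_smul]
  simp only [hpair, newtonPotential, Fintype.sum_option, Fintype.sum_prod_type, spiderwebMass,
    spiderwebPosition_none, sub_zero, zero_sub, norm_neg, norm_zero, inv_zero, mul_zero, zero_add,
    norm_spiderwebPosition_some (hr _), Finset.sum_const, Finset.card_univ, Fintype.card_fin,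
    nsmul_eq_mul, Finset.sum_add_distrib]
  rw [show ∑ i, ∑ j, ∑ k : Fin ℓ, ∑ k' : Fin ℓ, m i * m j *
        ‖spiderwebPosition r (some (i, k)) - spiderwebPosition r (some (j, k'))‖⁻¹ =
      ∑ i, ∑ k : Fin ℓ, ∑ j, ∑ k' : Fin ℓ, m i * m j *
        ‖spiderwebPosition r (some (i, k)) - spiderwebPosition r (some (j, k'))‖⁻¹ from
    Finset.sum_congr rfl fun i _ => Finset.sum_comm, ← add_assoc, mul_add]
  congr 1
  rw [← Finset.sum_add_distrib, Finset.mul_sum]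
  exact Finset.sum_congr rfl fun i _ => by ring

theorem convexOn_inv_exp_eval (i : Fin n) :
    ConvexOn ℝ {u : Fin n → ℝ | StrictMono u} fun u => (Real.exp (u i))⁻¹ := by
  simpa only [one_mul, LinearMap.neg_apply, LinearMap.proj_apply, Real.exp_neg] using
    (convexOn_mul_exp_linearMap zero_le_one (-LinearMap.proj i)).subset (Set.subset_univ _)
      (convex_setOf_strictMono n)

theorem convexOn_ringPotential_exp_eval {κ : Type*} [Fintype κ] (w : κ → Circle) (i j : Fin n) :
    ConvexOn ℝ {u : Fin n → ℝ | StrictMono u} fun u =>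
      ringPotential w (Real.exp (u i)) (Real.exp (u j)) := by
  have hlt : ∀ i j, i < j → ConvexOn ℝ {u : Fin n → ℝ | StrictMono u} fun u =>
      ringPotential w (Real.exp (u i)) (Real.exp (u j)) := by
    intro i j hij
    have h := (convexOn_ringPotential_exp w).comp_linearMap
      ((LinearMap.proj i : (Fin n → ℝ) →ₗ[ℝ] ℝ).prod (LinearMap.proj j))
    exact h.subset (fun u hu => show u i < u j from hu hij) (convex_setOf_strictMono n)
  rcases lt_trichotomy i j with hij | rfl | hij
  · exact hlt i j hij
  · simp only [ringPotential_self w (Real.exp_pos _).le]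
    exact (convexOn_inv_exp_eval i).smul (ringPotential_nonneg w 1 1)
  · exact (hlt j i hij).congr fun u _ => ringPotential_comm _ _ _

theorem convexOn_newtonPotential_spiderweb_exp {m₀ : ℝ} {m : Fin n → ℝ} (hm₀ : 0 ≤ m₀)
    (hm : ∀ i, 0 ≤ m i) :
    ConvexOn ℝ {u : Fin n → ℝ | StrictMono u} fun u =>
      newtonPotential (spiderwebMass (ℓ := ℓ) m₀ m) (spiderwebPosition (Real.exp ∘ u)) := by
  have hs := convex_setOf_strictMono n
  have hcentral : ConvexOn ℝ {u : Fin n → ℝ | StrictMono u} fun u =>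
      ∑ i, ℓ * (m₀ * m i) * (Real.exp (u i))⁻¹ := convexOn_sum hs fun i =>
    (convexOn_inv_exp_eval i).smul (mul_nonneg (Nat.cast_nonneg ℓ) (mul_nonneg hm₀ (hm i)))
  have hrings : ConvexOn ℝ {u : Fin n → ℝ | StrictMono u} fun u => 2⁻¹ * ∑ i, ∑ j,
      m i * m j * ringPotential (polygonVertex ℓ) (Real.exp (u i)) (Real.exp (u j)) :=
    (convexOn_sum hs fun i => convexOn_sum hs fun j =>
      (convexOn_ringPotential_exp_eval (polygonVertex ℓ) i j).smul
        (mul_nonneg (hm i) (hm j))).smul (by norm_num)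
  refine (hcentral.add hrings).congr fun u _ => ?_
  exact (newtonPotential_spiderweb m₀ m fun i => (Real.exp_pos (u i)).le).symm

/-- The augmented potential of a spiderweb as a function of its radii. -/
noncomputable def spiderwebAugmentedPotential (ℓ : ℕ) (m₀ : ℝ) (m : Fin n → ℝ) (lam : ℝ)
    (r : Fin n → ℝ) : ℝ :=
  augmentedPotential (spiderwebMass (ℓ := ℓ) m₀ m) lam (spiderwebPosition r)

theorem sum_spiderwebMass_mul_norm_sq (m₀ : ℝ) (m : Fin n → ℝ) {r : Fin n → ℝ}
    (hr : ∀ i, 0 ≤ r i) :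
    ∑ a, spiderwebMass (ℓ := ℓ) m₀ m a * ‖spiderwebPosition (ℓ := ℓ) r a‖ ^ 2 =
      ∑ i, ℓ * (m i * r i ^ 2) := by
  simp only [Fintype.sum_option, Fintype.sum_prod_type, spiderwebMass, spiderwebPosition_none,
    norm_zero, norm_spiderwebPosition_some (hr _), Finset.sum_const, Finset.card_univ,
    Fintype.card_fin, nsmul_eq_mul, ne_eq, two_ne_zero, not_false_eq_true, zero_pow, mul_zero,
    zero_add]

theorem strictConvexOn_spiderwebAugmentedPotential_exp {m₀ lam : ℝ} {m : Fin n → ℝ}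
    (hm₀ : 0 ≤ m₀) (hm : ∀ i, 0 < m i) (hlam : lam < 0) :
    StrictConvexOn ℝ {u : Fin n → ℝ | StrictMono u} fun u =>
      spiderwebAugmentedPotential ℓ m₀ m lam (Real.exp ∘ u) := by
  have hcoeff : ∀ i, 0 < -(lam / 2) * (ℓ * m i) := fun i =>
    mul_pos (by linarith) (mul_pos (Nat.cast_pos.mpr (NeZero.pos ℓ)) (hm i))
  have hinertia : StrictConvexOn ℝ Set.univ fun u : Fin n → ℝ =>
      ∑ i, -(lam / 2) * (ℓ * m i) * Real.exp (u i) ^ 2 :=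
    strictConvexOn_sum_comp_eval fun i => strictConvexOn_mul_exp_sq (hcoeff i)
  have hsum := (convexOn_newtonPotential_spiderweb_exp (ℓ := ℓ) hm₀ fun i =>
    (hm i).le).add_strictConvexOn
      (hinertia.subset (Set.subset_univ _) (convex_setOf_strictMono n))
  refine hsum.congr fun u _ => ?_
  rw [spiderwebAugmentedPotential, augmentedPotential,
    sum_spiderwebMass_mul_norm_sq m₀ m (r := Real.exp ∘ u) fun i => (Real.exp_pos (u i)).le,
    sub_eq_add_neg, ← neg_mul, Finset.mul_sum]
  simp only [Pi.add_apply, mul_assoc, Function.comp_apply]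

end Convexity

section Variation

variable {n ℓ : ℕ} [NeZero ℓ] {c : ℝ → Fin n → ℝ} {c' : Fin n → ℝ} {t : ℝ}

theorem hasDerivAt_spiderwebPosition (hc : HasDerivAt c c' t) (a : Option (Fin n × Fin ℓ)) :
    HasDerivAt (fun s => spiderwebPosition (c s) a) (spiderwebPosition c' a) t := by
  rcases a with _ | ⟨i, k⟩
  · exact hasDerivAt_const t _
  · simpa only [spiderwebPosition_some] using (hasDerivAt_pi.mp hc i).smul_const _

theorem hasDerivAt_spiderwebAugmentedPotential (m₀ : ℝ) (m : Fin n → ℝ) (lam : ℝ)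
    (hc : HasDerivAt c c' t) (hct : c t ∈ orderedRadii n) :
    HasDerivAt (fun s => spiderwebAugmentedPotential ℓ m₀ m lam (c s))
      (ℓ * ∑ i, m i * ((radialAcceleration ℓ m₀ m (c t) i - lam * c t i) * c' i)) t := by
  refine (hasDerivAt_augmentedPotential (spiderwebMass m₀ m) lam
    (hasDerivAt_spiderwebPosition hc) (spiderwebPosition_injective hct)).congr_deriv ?_
  rw [Fintype.sum_option, spiderwebPosition_none c', inner_zero_right, mul_zero, zero_add,
    Fintype.sum_prod_type, Finset.mul_sum]
  refine Finset.sum_congr rfl fun i _ => ?_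
  simp only [newtonAcceleration_spiderweb_some, spiderwebPosition_some, smul_smul, ← sub_smul,
    real_inner_smul_left, real_inner_smul_right, real_inner_self_eq_norm_sq,
    LinearIsometry.norm_map, Circle.norm_coe, spiderwebMass, Finset.sum_const, Finset.card_univ,
    Fintype.card_fin, nsmul_eq_mul]
  ring

theorem hasDerivAt_zero_of_isSpiderwebCentralConfiguration {m₀ lam : ℝ} {m : Fin n → ℝ}
    (hc : HasDerivAt c c' t) (h : IsSpiderwebCentralConfiguration n ℓ m₀ m lam (c t)) :
    HasDerivAt (fun s => spiderwebAugmentedPotential ℓ m₀ m lam (c s)) 0 t := by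
  refine (hasDerivAt_augmentedPotential (spiderwebMass m₀ m) lam
    (hasDerivAt_spiderwebPosition hc) h.2.1).congr_deriv ?_
  simp only [h.2.2, sub_self, inner_zero_left, mul_zero, Finset.sum_const_zero]

theorem isOpen_orderedRadii (n : ℕ) : IsOpen (orderedRadii n) := by
  have hinter : orderedRadii n = (⋂ i, {r | 0 < r i}) ∩
      ⋂ i, ⋂ j, ⋂ (_ : i < j), {r | r i < r j} := by
    ext r
    simp only [orderedRadii, StrictMono, Set.mem_ofPred_eq, Set.mem_inter_iff, Set.mem_iInter]
  rw [hinter]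
  exact (isOpen_iInter_of_finite fun i => isOpen_lt continuous_const (continuous_apply i)).inter
    (isOpen_iInter_of_finite fun i => isOpen_iInter_of_finite fun j =>
      isOpen_iInter_of_finite fun _ => isOpen_lt (continuous_apply i) (continuous_apply j))

/-- The derivative in the direction of the weighted gradient, whose components are
`radialAcceleration ℓ m₀ m r i - lam * r i`, is a positive combination of their squares. -/
theorem isSpiderwebCentralConfiguration_of_isMinOn (hℓ : 2 ≤ ℓ) {m₀ lam : ℝ} {m r : Fin n → ℝ}
    (hm : ∀ i, 0 < m i) (hr : r ∈ orderedRadii n)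
    (hmin : IsMinOn (spiderwebAugmentedPotential ℓ m₀ m lam) (orderedRadii n) r) :
    IsSpiderwebCentralConfiguration n ℓ m₀ m lam r := by
  set g : Fin n → ℝ := fun i => radialAcceleration ℓ m₀ m r i - lam * r i
  set c : ℝ → Fin n → ℝ := fun s => r + s • g
  have hc0 : c 0 = r := by simp only [c, zero_smul, add_zero]
  have hc : HasDerivAt c g 0 := by
    have h := ((hasDerivAt_id (0 : ℝ)).smul_const g).const_add r
    rwa [one_smul] at h
  have hderiv := hasDerivAt_spiderwebAugmentedPotential (ℓ := ℓ) m₀ m lam hc (hc0 ▸ hr)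
  have hlocal : IsLocalMin (fun s => spiderwebAugmentedPotential ℓ m₀ m lam (c s)) 0 := by
    filter_upwards [hc.continuousAt ((isOpen_orderedRadii n).mem_nhds (hc0 ▸ hr))] with s hs
    rw [hc0]
    exact hmin hs
  have hsum : ∑ i, m i * (g i * g i) = 0 := by
    have h := hlocal.hasDerivAt_eq_zero hderiv
    rw [hc0] at h
    exact (mul_eq_zero.mp h).resolve_left (Nat.cast_ne_zero.mpr (NeZero.ne ℓ))
  rw [Finset.sum_eq_zero_iff_of_nonneg fun i _ =>
    mul_nonneg (hm i).le (mul_self_nonneg _)] at hsum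
  refine (isSpiderwebCentralConfiguration_iff hℓ m₀ m lam r).mpr ⟨hr, fun i => ?_⟩
  exact sub_eq_zero.mp (mul_self_eq_zero.mp
    ((mul_eq_zero.mp (hsum i (Finset.mem_univ i))).resolve_left (hm i).ne'))

end Variation

section Existence

theorem orderedRadii_nonempty (n : ℕ) : (orderedRadii n).Nonempty :=
  ⟨fun i => (i : ℕ) + 1, fun i => by positivity, fun i j h => by simpa using h⟩

theorem isCompact_Icc_inter_gap_le {n : ℕ} (A R : Fin n → ℝ) (B : Fin n → Fin n → ℝ) :
    IsCompact (Set.Icc A R ∩ {r | ∀ i j, i < j → B i j ≤ r j - r i}) := by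
  refine isCompact_Icc.inter_right ?_
  simp only [Set.ofPred_forall]
  exact isClosed_iInter fun i => isClosed_iInter fun j => isClosed_iInter fun _ =>
    isClosed_le continuous_const ((continuous_apply j).sub (continuous_apply i))

theorem Icc_inter_gap_subset_orderedRadii {n : ℕ} {A R : Fin n → ℝ} {B : Fin n → Fin n → ℝ}
    (hA : ∀ i, 0 < A i) (hB : ∀ i j, 0 < B i j) :
    Set.Icc A R ∩ {r | ∀ i j, i < j → B i j ≤ r j - r i} ⊆ orderedRadii n := fun _ hr =>
  ⟨fun i => (hA i).trans_le (hr.1.1 i),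
    fun i j hij => sub_pos.mp ((hB i j).trans_le (hr.2 i j hij))⟩

variable {n ℓ : ℕ} {m₀ lam : ℝ} {m r : Fin n → ℝ}

theorem spiderwebMass_nonneg (hm₀ : 0 ≤ m₀) (hm : ∀ i, 0 ≤ m i) (a : Option (Fin n × Fin ℓ)) :
    0 ≤ spiderwebMass m₀ m a := by
  rcases a with _ | ⟨i, -⟩
  exacts [hm₀, hm i]

variable [NeZero ℓ]

theorem continuousOn_spiderwebAugmentedPotential (m₀ : ℝ) (m : Fin n → ℝ) (lam : ℝ) :
    ContinuousOn (spiderwebAugmentedPotential ℓ m₀ m lam) (orderedRadii n) := by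
  have hposition : Continuous (spiderwebPosition (n := n) (ℓ := ℓ)) := by
    refine continuous_pi fun a => ?_
    rcases a with _ | ⟨i, k⟩
    · exact continuous_const
    · simp only [spiderwebPosition_some]
      fun_prop
  exact (continuousOn_augmentedPotential (spiderwebMass m₀ m) lam).comp hposition.continuousOn
    fun _ hr => spiderwebPosition_injective hr

theorem mass_mul_mass_le_of_dist_le (hm₀ : 0 ≤ m₀) (hm : ∀ i, 0 ≤ m i) (hlam : lam ≤ 0)
    (hr : r ∈ orderedRadii n) {a b : Option (Fin n × Fin ℓ)} (hab : a ≠ b) {d : ℝ}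
    (hd : ‖spiderwebPosition r a - spiderwebPosition r b‖ ≤ d) :
    spiderwebMass m₀ m a * spiderwebMass m₀ m b ≤
      2 * spiderwebAugmentedPotential ℓ m₀ m lam r * d := by
  have hM := spiderwebMass_nonneg (ℓ := ℓ) hm₀ hm
  have hU := newtonPotential_nonneg hM (spiderwebPosition r)
  have hUF := newtonPotential_le_augmentedPotential hM hlam (spiderwebPosition r)
  refine (mul_le_two_mul_newtonPotential_mul_norm_sub hM
    ((spiderwebPosition_injective hr).ne hab)).trans ?_
  exact mul_le_mul (mul_le_mul_of_nonneg_left hUF zero_le_two) hd (norm_nonneg _)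
    (mul_nonneg zero_le_two (hU.trans hUF))

theorem sq_mass_le_potential_mul_radius (hℓ : 2 ≤ ℓ) (hm₀ : 0 ≤ m₀) (hm : ∀ i, 0 ≤ m i)
    (hlam : lam ≤ 0) (hr : r ∈ orderedRadii n) (i : Fin n) :
    m i ^ 2 ≤ 2 * spiderwebAugmentedPotential ℓ m₀ m lam r * (2 * r i) := by
  have hne : (some (i, 0) : Option (Fin n × Fin ℓ)) ≠ some (i, ⟨1, hℓ⟩) := by
    simp [Fin.ext_iff]
  have hdist : ‖spiderwebPosition r (some (i, (0 : Fin ℓ))) -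
      spiderwebPosition r (some (i, ⟨1, hℓ⟩))‖ ≤ 2 * r i := by
    refine (norm_sub_le _ _).trans_eq ?_
    rw [norm_spiderwebPosition_some (hr.1 i).le, norm_spiderwebPosition_some (hr.1 i).le, two_mul]
  simpa only [spiderwebMass, ← sq] using mass_mul_mass_le_of_dist_le hm₀ hm hlam hr hne hdist

theorem mass_mul_mass_le_potential_mul_gap (hm₀ : 0 ≤ m₀) (hm : ∀ i, 0 ≤ m i) (hlam : lam ≤ 0)
    (hr : r ∈ orderedRadii n) {i j : Fin n} (hij : i < j) :
    m i * m j ≤ 2 * spiderwebAugmentedPotential ℓ m₀ m lam r * (r j - r i) := by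
  have hne : (some (i, 0) : Option (Fin n × Fin ℓ)) ≠ some (j, 0) := by
    simpa only [ne_eq, Option.some_inj, Prod.mk.injEq, and_true] using hij.ne
  have hdist : ‖spiderwebPosition r (some (i, (0 : Fin ℓ))) -
      spiderwebPosition r (some (j, (0 : Fin ℓ)))‖ ≤ r j - r i := by
    rw [spiderwebPosition_some, spiderwebPosition_some, ← sub_smul, norm_smul,
      LinearIsometry.norm_map, Circle.norm_coe, mul_one, norm_sub_rev,
      Real.norm_of_nonneg (sub_nonneg.mpr (hr.2 hij).le)]
  exact mass_mul_mass_le_of_dist_le hm₀ hm hlam hr hne hdist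

theorem mul_radius_sq_le_spiderwebAugmentedPotential (hm₀ : 0 ≤ m₀) (hm : ∀ i, 0 ≤ m i)
    (hlam : lam ≤ 0) (hr : r ∈ orderedRadii n) (i : Fin n) :
    -lam / 2 * (m i * r i ^ 2) ≤ spiderwebAugmentedPotential ℓ m₀ m lam r := by
  have h := mul_norm_sq_le_augmentedPotential (spiderwebMass_nonneg (ℓ := ℓ) hm₀ hm) hlam
    (spiderwebPosition r) (some (i, 0))
  rwa [norm_spiderwebPosition_some (hr.1 i).le] at h

theorem exists_isCompact_sublevel_subset (hℓ : 2 ≤ ℓ) (hm₀ : 0 ≤ m₀) (hm : ∀ i, 0 < m i)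
    (hlam : lam < 0) {C : ℝ} (hC : 0 < C) :
    ∃ K ⊆ orderedRadii n, IsCompact K ∧
      {r ∈ orderedRadii n | spiderwebAugmentedPotential ℓ m₀ m lam r ≤ C} ⊆ K := by
  have hlam' : 0 < -lam / 2 := by linarith
  refine ⟨_, Icc_inter_gap_subset_orderedRadii (A := fun i => m i ^ 2 / (4 * C))
      (R := fun i => √(C / (-lam / 2 * m i))) (B := fun i j => m i * m j / (2 * C))
      (fun i => div_pos (pow_pos (hm i) 2) (by positivity))
      (fun i j => div_pos (mul_pos (hm i) (hm j)) (by positivity)),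
    isCompact_Icc_inter_gap_le _ _ _,
    fun r ⟨hr, hrC⟩ => ⟨⟨fun i => ?_, fun i => ?_⟩, fun i j hij => ?_⟩⟩
  · have h := sq_mass_le_potential_mul_radius hℓ hm₀ (fun i => (hm i).le) hlam.le hr i
    rw [div_le_iff₀ (by positivity)]
    linarith [mul_le_mul_of_nonneg_right hrC (hr.1 i).le]
  · have h := mul_radius_sq_le_spiderwebAugmentedPotential (ℓ := ℓ) hm₀ (fun i => (hm i).le)
      hlam.le hr i
    refine Real.le_sqrt_of_sq_le ((le_div_iff₀ (mul_pos hlam' (hm i))).mpr ?_)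
    linarith
  · have h := mass_mul_mass_le_potential_mul_gap (ℓ := ℓ) hm₀ (fun i => (hm i).le) hlam.le hr hij
    rw [div_le_iff₀ (by positivity)]
    linarith [mul_le_mul_of_nonneg_right hrC (sub_nonneg.mpr (hr.2 hij).le)]

theorem exists_isMinOn_spiderwebAugmentedPotential (hℓ : 2 ≤ ℓ) (hm₀ : 0 ≤ m₀)
    (hm : ∀ i, 0 < m i) (hlam : lam < 0) :
    ∃ r ∈ orderedRadii n,
      IsMinOn (spiderwebAugmentedPotential ℓ m₀ m lam) (orderedRadii n) r := by
  obtain ⟨r₀, hr₀⟩ := orderedRadii_nonempty n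
  set C := max (spiderwebAugmentedPotential ℓ m₀ m lam r₀) 1
  obtain ⟨K, hK, hcompact, hsublevel⟩ :=
    exists_isCompact_sublevel_subset (C := C) hℓ hm₀ hm hlam (by positivity)
  have hr₀K : r₀ ∈ K := hsublevel ⟨hr₀, le_max_left _ _⟩
  obtain ⟨r, hr, hmin⟩ := hcompact.exists_isMinOn ⟨r₀, hr₀K⟩
    ((continuousOn_spiderwebAugmentedPotential (ℓ := ℓ) m₀ m lam).mono hK)
  refine ⟨r, hK hr, fun s hs => ?_⟩
  rcases le_total (spiderwebAugmentedPotential ℓ m₀ m lam s) C with hsC | hsC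
  · exact hmin (hsublevel ⟨hs, hsC⟩)
  · exact (hmin hr₀K).trans ((le_max_left _ _).trans hsC)

end Existence

section Uniqueness

theorem strictConvexOn_comp_lineMap {E : Type*} [AddCommGroup E] [Module ℝ E] {s : Set E}
    {f : E → ℝ} (hf : StrictConvexOn ℝ s f) {x y : E} (hx : x ∈ s) (hy : y ∈ s) (hxy : x ≠ y) :
    StrictConvexOn ℝ (Set.Icc 0 1) fun t : ℝ => f (AffineMap.lineMap x y t) := by
  refine ⟨convex_Icc 0 1, fun t ht t' ht' htt' a b ha hb hab => ?_⟩
  simp only [Convex.combo_affine_apply hab]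
  exact hf.2 (hf.1.lineMap_mem hx hy ht) (hf.1.lineMap_mem hx hy ht')
    ((AffineMap.lineMap_injective ℝ hxy).ne htt') ha hb hab

theorem eq_of_strictConvexOn_of_hasDerivAt_lineMap {E : Type*} [AddCommGroup E] [Module ℝ E]
    {s : Set E} {f : E → ℝ} (hf : StrictConvexOn ℝ s f) {x y : E} (hx : x ∈ s) (hy : y ∈ s)
    (hderiv₀ : HasDerivAt (fun t : ℝ => f (AffineMap.lineMap x y t)) 0 0)
    (hderiv₁ : HasDerivAt (fun t : ℝ => f (AffineMap.lineMap x y t)) 0 1) : x = y := by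
  by_contra hxy
  have hline := strictConvexOn_comp_lineMap hf hx hy hxy
  have h₀ : (0 : ℝ) ∈ Set.Icc 0 1 := Set.left_mem_Icc.mpr zero_le_one
  have h₁ : (1 : ℝ) ∈ Set.Icc 0 1 := Set.right_mem_Icc.mpr zero_le_one
  exact lt_irrefl 0 ((hline.lt_slope_of_hasDerivAt h₀ h₁ one_pos hderiv₀).trans
    (hline.slope_lt_of_hasDerivAt h₀ h₁ one_pos hderiv₁))

variable {n ℓ : ℕ} [NeZero ℓ] {m₀ lam : ℝ} {m r r' : Fin n → ℝ}

theorem IsSpiderwebCentralConfiguration.constant_neg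
    (h : IsSpiderwebCentralConfiguration n ℓ m₀ m lam r) (hℓ : 2 ≤ ℓ) (hm₀ : 0 ≤ m₀)
    (hm : ∀ i, 0 < m i) (i : Fin n) : lam < 0 :=
  h.2.constant_neg (spiderwebMass_nonneg hm₀ fun i => (hm i).le)
    (a := some (i, 0)) (b := some (i, ⟨1, hℓ⟩)) (by simp [Fin.ext_iff]) (hm i) (hm i)

theorem IsSpiderwebCentralConfiguration.eq
    (h : IsSpiderwebCentralConfiguration n ℓ m₀ m lam r)
    (h' : IsSpiderwebCentralConfiguration n ℓ m₀ m lam r') (hm₀ : 0 ≤ m₀)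
    (hm : ∀ i, 0 < m i) (hlam : lam < 0) : r = r' := by
  have hexp_log : ∀ {ρ}, ρ ∈ orderedRadii n → Real.exp ∘ Real.log ∘ ρ = ρ := fun hρ =>
    funext fun i => Real.exp_log (hρ.1 i)
  have hlog_mono : ∀ {ρ}, ρ ∈ orderedRadii n → StrictMono (Real.log ∘ ρ) := fun hρ i j hij =>
    Real.log_lt_log (hρ.1 i) (hρ.2 hij)
  set u := Real.log ∘ r
  set u' := Real.log ∘ r'
  have hcurve : ∀ t, HasDerivAt (fun s : ℝ => Real.exp ∘ AffineMap.lineMap u u' s)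
      (fun i => Real.exp (AffineMap.lineMap u u' t i) * (u' - u) i) t := fun t =>
    hasDerivAt_pi.mpr fun i =>
      (hasDerivAt_pi.mp (AffineMap.hasDerivAt_lineMap (a := u) (b := u') (x := t)) i).exp
  have hlog : u = u' := by
    refine eq_of_strictConvexOn_of_hasDerivAt_lineMap
      (strictConvexOn_spiderwebAugmentedPotential_exp (ℓ := ℓ) hm₀ hm hlam)
      (hlog_mono h.1) (hlog_mono h'.1)
      (hasDerivAt_zero_of_isSpiderwebCentralConfiguration (hcurve 0) ?_)
      (hasDerivAt_zero_of_isSpiderwebCentralConfiguration (hcurve 1) ?_)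
    · rwa [AffineMap.lineMap_apply_zero, hexp_log h.1]
    · rwa [AffineMap.lineMap_apply_one, hexp_log h'.1]
  rw [← hexp_log h.1, ← hexp_log h'.1]
  exact congrArg (Real.exp ∘ ·) hlog

end Uniqueness

theorem mainTheorem2_general (n ℓ : ℕ) (hℓ : 2 ≤ ℓ) (m₀ : ℝ) (m : Fin n → ℝ)
    (hm₀ : 0 ≤ m₀) (hm : ∀ i, 0 < m i) :
    (∀ lam : ℝ, lam < 0 → ∃ r : Fin n → ℝ, IsSpiderwebCentralConfiguration n ℓ m₀ m lam r) ∧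
      ∀ (lam : ℝ) (r r' : Fin n → ℝ), IsSpiderwebCentralConfiguration n ℓ m₀ m lam r →
        IsSpiderwebCentralConfiguration n ℓ m₀ m lam r' → r = r' := by
  have : NeZero ℓ := ⟨by lia⟩
  refine ⟨fun lam hlam => ?_, fun lam r r' h h' => funext fun i => congrFun ?_ i⟩
  · obtain ⟨r, hr, hmin⟩ := exists_isMinOn_spiderwebAugmentedPotential hℓ hm₀ hm hlam
    exact ⟨r, isSpiderwebCentralConfiguration_of_isMinOn hℓ hm hr hmin⟩
  · exact h.eq h' hm₀ hm (h.constant_neg hℓ hm₀ hm i)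

theorem mainTheorem2 (n ℓ : ℕ) (hℓ : 2 ≤ ℓ) (m₀ : ℝ) (m : Fin n → ℝ)
    (hm₀ : 0 ≤ m₀) (hm : ∀ i, 0 < m i) (hn : n ≤ 4) :
    (∀ lam : ℝ, lam < 0 → ∃ r : Fin n → ℝ, IsSpiderwebCentralConfiguration n ℓ m₀ m lam r) ∧
      (n = 2 → ∀ (lam : ℝ) (r r' : Fin n → ℝ),
        IsSpiderwebCentralConfiguration n ℓ m₀ m lam r →
        IsSpiderwebCentralConfiguration n ℓ m₀ m lam r' → r = r') :=
  (mainTheorem2_general n ℓ hℓ m₀ m hm₀ hm).imp_right fun h _ => h
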